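/- All formal group laws are one-dimensional and commutative. A homomorphism $(f,\alpha)\colon (F_1,R_1)\to(F_2,R_2)$ between formal group laws $F_1$ over $R_1$ and $F_2$ over $R_2$ is a pair consisting of a ring homomorphism $\alpha\colon R_2\to R_1$ and a homomorphism $f\colon F_1\to\alpha^*F_2$ of formal group laws over $R_1$ in the usual sense; composition is $(g,\beta)\circ(f,\alpha)=(\alpha^*g\circ f,\ \alpha\circ\beta)$, the identity is $(X,\mathrm{id})$, and an isomorphism is a homomorphism with a two-sided inverse. Let $R$ be a complete Noetherian local ring with residue field $k$ of characteristic $p>0$, and let $G$ be a formal group law over $k$. For a complete Noetherian local $R$-algebra $A$ (with local structure map) with maximal ideal $\mathfrak m$, projection $\pi\colon A\to A/\mathfrak m$ and induced inclusion $\iota\colon k\to A/\mathfrak m$, a deformation of $G$ to $A$ is a formal group law $\widetilde G$ over $A$ with $\iota^*G=\pi^*\widetilde G$. Two formal group laws over $A$ are $*$-isomorphic if there is an isomorphism $u$ between them over $A$ with $\pi^*u=X$. A deformation $\widetilde G$ of $G$ to $R[[t_1,\dots,t_m]]$ is universal if for every such $A$ and every deformation $G'$ of $G$ to $A$ there is a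 unique local $R$-algebra homomorphism $\alpha\colon R[[t_1,\dots,t_m]]\to A$ such that $\alpha^*\widetilde G$ is $*$-isomorphic to $G'$. **Lemma.** Let $F$ and $G$ be formal group laws of the same finite height $n$ over $k$, and let $(\bar f,\bar\alpha)\colon (F,k)\to(G,k)$ be an isomorphism. Let $\alpha$ be a ring automorphism of $R$ that induces $\bar\alpha$ on the residue field $k$. Let $\widetilde F$ be a universal deformation of $F$ over $R[[u_1,\dots,u_{n-1}]]$ and $\widetilde G$ a universal deformation of $G$ over $R[[w_1,\dots,w_{n-1}]]$. Then there is a unique isomorphism $$(g,\beta)\colon (\widetilde F,R[[u_1,\dots,u_{n-1}]])\to(\widetilde G,R[[w_1,\dots,w_{n-1}]])$$ that induces $(\bar f,\bar\alpha)$ on the residue fields and satisfies $i\circ\alpha=\beta\circ j$, where $i\colon R\to R[[u_1,\dots,u_{n-1}]]$ and $j\colon R\to R[[w_1,\dots,w_{n-1}]]$ are the canonical inclusions. -/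

import Mathlib

open IsLocalRing

noncomputable section

namespace FormalGroup

section Homs

variable {R : Type*} [CommRing R]

/-- `F.IsHom G f`: the power series `f` without constant term is a homomorphism `F → G` of
formal group laws over `R` in the usual sense, `f(F(X, Y)) = G(f(X), f(Y))`. -/
structure IsHom (F G : FormalGroup R) (f : PowerSeries R) : Prop where
  constantCoeff_eq_zero : PowerSeries.constantCoeff f = 0
  subst_eq : PowerSeries.subst F.toPowerSeries f =
    G.toPowerSeries.subst ![
      PowerSeries.subst (MvPowerSeries.X 0 : MvPowerSeries (Fin 2) R) f,
      PowerSeries.subst (MvPowerSeries.X 1 : MvPowerSeries (Fin 2) R) f]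

/-- `F.IsIsom G f`: `f` is an isomorphism `F → G` of formal group laws over `R` in the usual
sense, that is, a homomorphism with a two-sided inverse under composition of power series. -/
def IsIsom (F G : FormalGroup R) (f : PowerSeries R) : Prop :=
  F.IsHom G f ∧ ∃ g : PowerSeries R, G.IsHom F g ∧
    PowerSeries.subst f g = PowerSeries.X ∧ PowerSeries.subst g f = PowerSeries.X

/-- The multiplication-by-`m` series: `[0]_F(X) = 0` and `[m + 1]_F(X) = F([m]_F(X), X)`. -/
def mulSeries (F : FormalGroup R) : ℕ → PowerSeries R
  | 0 => 0
  | m + 1 => F.toPowerSeries.subst ![mulSeries F m, PowerSeries.X]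

/-- `F` has (finite) height `n` at `p`: `[p]_F(X) = g(X ^ (p ^ n))` with `g'(0) ≠ 0`. -/
def HasHeight (F : FormalGroup R) (p n : ℕ) : Prop :=
  ∃ g : PowerSeries R, PowerSeries.coeff 1 g ≠ 0 ∧
    F.mulSeries p = PowerSeries.subst (PowerSeries.X ^ (p ^ n) : PowerSeries R) g

lemma IsHom.hasSubst {F G : FormalGroup R} {f : PowerSeries R} (h : F.IsHom G f) :
    PowerSeries.HasSubst f :=
  PowerSeries.HasSubst.of_constantCoeff_zero' h.constantCoeff_eq_zero

lemma hasSubst_toPowerSeries (F : FormalGroup R) : PowerSeries.HasSubst F.toPowerSeries :=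
  PowerSeries.HasSubst.of_constantCoeff_zero F.zero_constantCoeff

lemma hasSubst_pair {f : PowerSeries R} (hf : PowerSeries.constantCoeff f = 0) :
    MvPowerSeries.HasSubst ![
      PowerSeries.subst (MvPowerSeries.X 0 : MvPowerSeries (Fin 2) R) f,
      PowerSeries.subst (MvPowerSeries.X 1 : MvPowerSeries (Fin 2) R) f] := by
  refine MvPowerSeries.hasSubst_of_constantCoeff_zero fun i => ?_
  fin_cases i
  · exact PowerSeries.constantCoeff_subst_eq_zero (by simp) f hf
  · exact PowerSeries.constantCoeff_subst_eq_zero (by simp) f hf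

lemma isHom_id (F : FormalGroup R) : F.IsHom F PowerSeries.X where
  constantCoeff_eq_zero := by simp
  subst_eq := by
    rw [PowerSeries.subst_X F.hasSubst_toPowerSeries, PowerSeries.subst_X (.X 0),
      PowerSeries.subst_X (.X 1)]
    have h : (![MvPowerSeries.X 0, MvPowerSeries.X 1] : Fin 2 → MvPowerSeries (Fin 2) R) =
        MvPowerSeries.X := by
      ext1 i; fin_cases i <;> rfl
    rw [h, MvPowerSeries.subst_self]; rfl

lemma IsHom.comp {F G H : FormalGroup R} {f g : PowerSeries R} (hg : G.IsHom H g)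
    (hf : F.IsHom G f) : F.IsHom H (PowerSeries.subst f g) where
  constantCoeff_eq_zero :=
    PowerSeries.constantCoeff_subst_eq_zero hf.constantCoeff_eq_zero g hg.constantCoeff_eq_zero
  subst_eq := by
    have hv := hasSubst_pair hf.constantCoeff_eq_zero
    rw [PowerSeries.subst_comp_subst_apply hf.hasSubst F.hasSubst_toPowerSeries, hf.subst_eq,
      PowerSeries.subst_comp_subst_apply hf.hasSubst (.X 0),
      PowerSeries.subst_comp_subst_apply hf.hasSubst (.X 1)]
    have h1 := congrArg (MvPowerSeries.subst ![
      PowerSeries.subst (MvPowerSeries.X 0 : MvPowerSeries (Fin 2) R) f,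
      PowerSeries.subst (MvPowerSeries.X 1 : MvPowerSeries (Fin 2) R) f]) hg.subst_eq
    rw [MvPowerSeries.subst_comp_subst_apply (hasSubst_pair hg.constantCoeff_eq_zero) hv] at h1
    unfold PowerSeries.subst at h1 hv ⊢
    erw [MvPowerSeries.subst_comp_subst_apply G.hasSubst_toPowerSeries.const hv] at h1
    rw [h1]
    congr 1
    ext1 i
    fin_cases i
    · simp only [Fin.zero_eta, Matrix.cons_val_zero]
      rw [MvPowerSeries.subst_comp_subst_apply (PowerSeries.HasSubst.X 0).const hv]
      simp [MvPowerSeries.subst_X hv]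
    · simp only [Fin.mk_one, Matrix.cons_val_one, Matrix.cons_val_fin_one]
      rw [MvPowerSeries.subst_comp_subst_apply (PowerSeries.HasSubst.X 1).const hv]
      simp [MvPowerSeries.subst_X hv]

lemma IsHom.map {S : Type*} [CommRing S] {F G : FormalGroup R} {f : PowerSeries R}
    (hf : F.IsHom G f) (α : R →+* S) : (F.map α).IsHom (G.map α) (PowerSeries.map α f) where
  constantCoeff_eq_zero := by
    have := hf.constantCoeff_eq_zero
    rw [← PowerSeries.coeff_zero_eq_constantCoeff_apply] at this ⊢
    rw [PowerSeries.coeff_map, this, map_zero]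
  subst_eq := by
    have h := congrArg (MvPowerSeries.map α) hf.subst_eq
    rw [PowerSeries.map_subst F.hasSubst_toPowerSeries,
      MvPowerSeries.map_subst (hasSubst_pair hf.constantCoeff_eq_zero)] at h
    rw [map_toPowerSeries, map_toPowerSeries, h]
    congr 1
    ext1 i
    fin_cases i
    · simp [PowerSeries.map_subst (PowerSeries.HasSubst.X (0 : Fin 2))]
    · simp [PowerSeries.map_subst (PowerSeries.HasSubst.X (1 : Fin 2))]

end Homs

end FormalGroup

/-- A homomorphism `(f, α) : (F₁, R₁) → (F₂, R₂)` between formal group laws over possibly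
different rings: a ring homomorphism `α : R₂ → R₁` together with a homomorphism
`f : F₁ → α^* F₂` over `R₁`. -/
@[ext]
structure FGLHom {R₁ R₂ : Type*} [CommRing R₁] [CommRing R₂]
    (F₁ : FormalGroup R₁) (F₂ : FormalGroup R₂) where
  series : PowerSeries R₁
  ringHom : R₂ →+* R₁
  isHom : F₁.IsHom (F₂.map ringHom) series

namespace FGLHom

variable {R₁ R₂ R₃ : Type*} [CommRing R₁] [CommRing R₂] [CommRing R₃]

/-- The identity `(X, id)`. -/
def id (F : FormalGroup R₁) : FGLHom F F where
  series := PowerSeries.X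
  ringHom := RingHom.id R₁
  isHom := by
    have h : F.map (RingHom.id R₁) = F := by
      ext1
      simp [MvPowerSeries.map_id]
    rw [h]
    exact F.isHom_id

/-- The composite `(g, β) ∘ (f, α) = (α^* g ∘ f, α ∘ β)`. -/
def comp {F₁ : FormalGroup R₁} {F₂ : FormalGroup R₂} {F₃ : FormalGroup R₃}
    (ψ : FGLHom F₂ F₃) (φ : FGLHom F₁ F₂) : FGLHom F₁ F₃ where
  series := PowerSeries.subst φ.series (PowerSeries.map φ.ringHom ψ.series)
  ringHom := φ.ringHom.comp ψ.ringHom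
  isHom := by
    have h : F₃.map (φ.ringHom.comp ψ.ringHom) = (F₃.map ψ.ringHom).map φ.ringHom := by
      ext1
      simp [MvPowerSeries.map_map]
    rw [h]
    exact (ψ.isHom.map φ.ringHom).comp φ.isHom

/-- `(f, α)` is an isomorphism if it has a two-sided inverse. -/
def IsIso {F₁ : FormalGroup R₁} {F₂ : FormalGroup R₂} (φ : FGLHom F₁ F₂) : Prop :=
  ∃ ψ : FGLHom F₂ F₁, φ.comp ψ = FGLHom.id F₂ ∧ ψ.comp φ = FGLHom.id F₁

end FGLHom

section Deformations

instance MvPowerSeries.isLocalHom_algebraMap_self {σ R : Type*} [CommRing R] :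
    IsLocalHom (algebraMap R (MvPowerSeries σ R)) where
  map_nonunit a h := by
    have h' := h.map (MvPowerSeries.constantCoeff (σ := σ) (R := R))
    simpa [MvPowerSeries.algebraMap_apply] using h'

variable {R : Type*} [CommRing R] [IsLocalRing R]

/-- `Gt` is a deformation to the local `R`-algebra `A` of the formal group law `G` over the residue
field `k` of `R`: it is a commutative formal group law over `A` with `ι^* G = π^* Gt`, where
`ι : k → A / 𝔪` is the induced inclusion of residue fields and `π : A → A / 𝔪`. -/
structure IsDeformation {A : Type*} [CommRing A] [IsLocalRing A] [Algebra R A]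
    [IsLocalHom (algebraMap R A)] (G : FormalGroup (ResidueField R)) (Gt : FormalGroup A) :
    Prop where
  isComm : Gt.IsComm
  map_eq : G.map (ResidueField.map (algebraMap R A)) = Gt.map (residue A)

/-- `G₁` and `G₂` are `*`-isomorphic: there is an isomorphism `u : G₁ → G₂` over `A` reducing to
the identity series `X` over the residue field of `A`. -/
def StarIsomorphic {A : Type*} [CommRing A] [IsLocalRing A] (G₁ G₂ : FormalGroup A) : Prop :=
  ∃ u : PowerSeries A, G₁.IsIsom G₂ u ∧ PowerSeries.map (residue A) u = PowerSeries.X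

end Deformations

/-- `Gt` is a universal deformation of `G` over the power series ring `R⟦t_i⟧`: it is a deformation
of `G`, and for every complete Noetherian local `R`-algebra `A` (with local structure map) and
every deformation `G'` of `G` to `A` there is a unique local `R`-algebra homomorphism
`α : R⟦t_i⟧ → A` such that `α^* Gt` is `*`-isomorphic to `G'`. -/
structure IsUniversalDeformation.{u} {R : Type u} [CommRing R] [IsLocalRing R] {m : ℕ}
    (G : FormalGroup (ResidueField R)) (Gt : FormalGroup (MvPowerSeries (Fin m) R)) : Prop where
  isDeformation : IsDeformation G Gt
  existsUnique : ∀ (A : Type u) [CommRing A] [IsLocalRing A] [IsNoetherianRing A]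
    [IsAdicComplete (maximalIdeal A) A] [Algebra R A] [IsLocalHom (algebraMap R A)]
    (G' : FormalGroup A), IsDeformation G G' →
    ∃! α : MvPowerSeries (Fin m) R →ₐ[R] A,
      IsLocalHom (α : MvPowerSeries (Fin m) R →+* A) ∧
        StarIsomorphic (Gt.map (α : MvPowerSeries (Fin m) R →+* A)) G'

/-- Let `A` and `B` be local `R`-algebras, and `Ft`, `Gt` formal group laws over `A` and `B`.
A homomorphism `(g, β) : (Ft, A) → (Gt, B)` induces `(f, a) : (F, k) → (G, k)` on residue fields:
`β` is local, the map of residue fields `B / 𝔪_B → A / 𝔪_A` given by `β` restricts to `a` on `k`,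
and the reduction of `g` is `f`. -/
def FGLHom.InducesOnResidueField {R A B : Type*} [CommRing R] [IsLocalRing R]
    [CommRing A] [IsLocalRing A] [Algebra R A] [IsLocalHom (algebraMap R A)]
    [CommRing B] [IsLocalRing B] [Algebra R B] [IsLocalHom (algebraMap R B)]
    {Ft : FormalGroup A} {Gt : FormalGroup B} {F G : FormalGroup (ResidueField R)}
    (φ : FGLHom Ft Gt) (φ₀ : FGLHom F G) : Prop :=
  ∃ _ : IsLocalHom φ.ringHom,
    (ResidueField.map φ.ringHom).comp (ResidueField.map (algebraMap R B)) =
      (ResidueField.map (algebraMap R A)).comp φ₀.ringHom ∧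
    PowerSeries.map (residue A) φ.series =
      PowerSeries.map (ResidueField.map (algebraMap R A)) φ₀.series

end

/-! Existence. Base-change the series of `φ₀` to the residue field of `R⟦u⟧` and lift it
coefficientwise to an invertible series `f`, not yet a homomorphism out of `Ft`. Conjugating `Ft` by
`f` gives a group law that deforms `G` along the twisted structure map `R → R → R⟦u⟧` through `α`.
As `R⟦u⟧` is again complete Noetherian local (`MvPowerSeries.isAdicComplete_maximalIdeal`),
universality of `Gt` yields `β` compatible with `α` and a `*`-isomorphism from `β^* Gt` to the
conjugate; `f` followed by its inverse is the lift (`FGLHom.exists_isLift`).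

Uniqueness (`FGLHom.IsLift.unique`). For two lifts, one series composed with the inverse of the
other is a `*`-isomorphism between the two pullbacks of `Gt`, so universality equates the ring maps.
The series are then homomorphisms with the same source, target and reduction, and finite height
makes them equal (`FormalGroup.IsHom.eq_of_map_residue_eq`): comparing both with `[p]` improves a
congruence modulo `𝔪 ^ r` to one modulo `𝔪 ^ (r + 1)`.

Invertibility. Lift the inverse of `φ₀` as well; both composites lift an identity, hence are
identities. -/

noncomputable section

/-! ### Completeness of power series rings over a complete local ring. -/

namespace PowerSeries

variable {A : Type*} [CommRing A] [IsLocalRing A]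

lemma mem_maximalIdeal_iff {f : PowerSeries A} :
    f ∈ maximalIdeal (PowerSeries A) ↔ constantCoeff f ∈ maximalIdeal A := by
  simp only [mem_maximalIdeal, mem_nonunits_iff, isUnit_iff_constantCoeff]

/-- With `mem_maximalIdeal_pow` this describes the adic filtration coefficientwise: `X` has weight
one, so the `i`-th coefficient only needs the remaining `n - i` factors. -/
lemma coeff_mem_of_mem_maximalIdeal_pow (n : ℕ) :
    ∀ f ∈ maximalIdeal (PowerSeries A) ^ n, ∀ i, coeff i f ∈ maximalIdeal A ^ (n - i) := by
  induction n with
  | zero => simp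
  | succ n ih =>
    intro f hf
    rw [pow_succ] at hf
    refine Submodule.mul_induction_on hf (fun a ha b hb i => ?_) fun a b ha hb i => ?_
    · rw [coeff_mul]
      refine Ideal.sum_mem _ fun x hx => ?_
      have hx' := Finset.HasAntidiagonal.mem_antidiagonal.mp hx
      have hb' : coeff x.2 b ∈ maximalIdeal A ^ (1 - x.2) := by
        obtain h | h := Nat.eq_zero_or_pos x.2
        · simpa [h] using mem_maximalIdeal_iff.mp hb
        · simp [Nat.sub_eq_zero_of_le h]
      refine Ideal.pow_le_pow_right (n := n - x.1 + (1 - x.2)) (by omega) ?_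
      rw [pow_add]
      exact Ideal.mul_mem_mul (ih a ha x.1) hb'
    · rw [map_add]
      exact add_mem (ha i) (hb i)

lemma C_mem_maximalIdeal_pow {n : ℕ} {a : A} (ha : a ∈ maximalIdeal A ^ n) :
    C a ∈ maximalIdeal (PowerSeries A) ^ n := by
  have h : (maximalIdeal A).map (C : A →+* PowerSeries A) ≤ maximalIdeal (PowerSeries A) := by
    rw [Ideal.map_le_iff_le_comap]
    intro x hx
    rw [Ideal.mem_comap, mem_maximalIdeal_iff, constantCoeff_C]
    exact hx
  have h' := Ideal.mem_map_of_mem (C : A →+* PowerSeries A) ha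
  rw [Ideal.map_pow] at h'
  exact Ideal.pow_right_mono h n h'

lemma X_mem_maximalIdeal : (X : PowerSeries A) ∈ maximalIdeal (PowerSeries A) := by
  rw [mem_maximalIdeal_iff, constantCoeff_X]
  exact zero_mem _

lemma mem_maximalIdeal_pow {n : ℕ} {f : PowerSeries A}
    (hf : ∀ i, coeff i f ∈ maximalIdeal A ^ (n - i)) :
    f ∈ maximalIdeal (PowerSeries A) ^ n := by
  rw [eq_X_pow_mul_shift_add_trunc n f]
  refine add_mem (Ideal.mul_mem_right _ _ (Ideal.pow_mem_pow X_mem_maximalIdeal n)) ?_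
  have h : ((trunc n f : Polynomial A) : PowerSeries A) =
      ∑ i ∈ Finset.Ico 0 n, C (coeff i f) * X ^ i := by
    rw [trunc_apply, ← Polynomial.coeToPowerSeries.ringHom_apply, map_sum]
    simp [monomial_eq_C_mul_X_pow]
  rw [h]
  refine Ideal.sum_mem _ fun i hi => ?_
  have hi' := (Finset.mem_Ico.mp hi).2
  rw [show n = (n - i) + i by omega, pow_add]
  exact Ideal.mul_mem_mul (C_mem_maximalIdeal_pow (hf i)) (Ideal.pow_mem_pow X_mem_maximalIdeal i)

instance isPrecomplete_maximalIdeal [IsPrecomplete (maximalIdeal A) A] :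
    IsPrecomplete (maximalIdeal (PowerSeries A)) (PowerSeries A) where
  prec' f hf := by
    -- The `i`-th coefficient loses `i` steps of precision; shifting the sequence by `i`
    -- compensates.
    have key (i : ℕ) : ∃ L : A, ∀ n, coeff i (f (n + i)) - L ∈ maximalIdeal A ^ n := by
      obtain ⟨L, hL⟩ := IsPrecomplete.prec (I := maximalIdeal A) (M := A) inferInstance
        (f := fun n => coeff i (f (n + i))) (fun {a b} hab => by
          have := hf (Nat.add_le_add_right hab i)
          rw [SModEq.sub_mem] at this ⊢
          simp only [smul_eq_mul, Ideal.mul_top] at this ⊢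
          rw [← map_sub]
          simpa using coeff_mem_of_mem_maximalIdeal_pow _ _ this i)
      refine ⟨L, fun n => ?_⟩
      have := hL n
      rw [SModEq.sub_mem] at this
      simpa only [smul_eq_mul, Ideal.mul_top] using this
    choose L hL using key
    refine ⟨mk L, fun n => ?_⟩
    rw [SModEq.sub_mem, smul_eq_mul, Ideal.mul_top]
    refine mem_maximalIdeal_pow fun i => ?_
    rw [map_sub, coeff_mk]
    have h1 := hL i (n - i)
    have h2 := hf (show n ≤ (n - i) + i by omega)
    rw [SModEq.sub_mem, smul_eq_mul, Ideal.mul_top] at h2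
    have h3 := coeff_mem_of_mem_maximalIdeal_pow _ _ h2 i
    rw [map_sub] at h3
    simpa using add_mem h3 h1

end PowerSeries

lemma RingEquiv.map_maximalIdeal {A B : Type*} [CommRing A] [CommRing B] [IsLocalRing A]
    [IsLocalRing B] (e : A ≃+* B) : (maximalIdeal A).map e = maximalIdeal B := by
  have : ((maximalIdeal A).map e).IsMaximal := Ideal.map_isMaximal_of_equiv e
  exact eq_maximalIdeal this

theorem MvPowerSeries.isAdicComplete_maximalIdeal (A : Type*) [CommRing A] [IsLocalRing A]
    [IsNoetherianRing A] [IsAdicComplete (maximalIdeal A) A] (m : ℕ) :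
    IsAdicComplete (maximalIdeal (MvPowerSeries (Fin m) A)) (MvPowerSeries (Fin m) A) := by
  induction m with
  | zero =>
    have e := (isEmptyEquiv (Fin 0) A).toRingEquiv
    rw [← e.symm.map_maximalIdeal, IsAdicComplete.congr_ringEquiv]
    infer_instance
  | succ m ih =>
    let e := (finSuccEquiv A m).toRingEquiv
    rw [← e.symm.map_maximalIdeal, IsAdicComplete.congr_ringEquiv]
    -- Both halves come from instances; precompleteness is the coefficientwise limit constructed
    -- above.
    have : IsAdicComplete (maximalIdeal (PowerSeries (MvPowerSeries (Fin m) A)))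
      (PowerSeries (MvPowerSeries (Fin m) A)) := { }
    exact this

/-! ### Linear coefficients, multiplication series and inverses of homomorphisms. -/

namespace PowerSeries

variable {A : Type*} [CommRing A]

lemma coeff_one_subst {f g : PowerSeries A} (hf : constantCoeff f = 0) :
    coeff 1 (subst f g) = coeff 1 g * coeff 1 f := by
  rw [coeff_subst' (HasSubst.of_constantCoeff_zero' hf), finsum_eq_single _ 1]
  · simp
  · rintro (_ | _ | d) hd
    · simp [coeff_one]
    · simp at hd
    · obtain ⟨h, rfl⟩ := X_dvd_iff.mpr hf
      rw [mul_pow, coeff_X_pow_mul', if_neg (by omega), smul_zero]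

end PowerSeries

namespace FormalGroup

variable {A : Type*} [CommRing A]

lemma cons_X_X :
    (![MvPowerSeries.X 0, MvPowerSeries.X 1] : Fin 2 → MvPowerSeries (Fin 2) A) =
      MvPowerSeries.X := by
  ext1 i; fin_cases i <;> rfl

lemma hasSubst_cons {σ : Type*} {a b : MvPowerSeries σ A} (ha : PowerSeries.HasSubst a)
    (hb : PowerSeries.HasSubst b) : MvPowerSeries.HasSubst ![a, b] :=
  MvPowerSeries.hasSubst_of_constantCoeff_nilpotent fun s => by fin_cases s <;> simpa

lemma hasSubst_subst_cons {σ : Type*} {H : MvPowerSeries (Fin 2) A}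
    (hH : MvPowerSeries.constantCoeff H = 0) {a b : MvPowerSeries σ A}
    (ha : PowerSeries.HasSubst a) (hb : PowerSeries.HasSubst b) :
    PowerSeries.HasSubst (MvPowerSeries.subst ![a, b] H) :=
  MvPowerSeries.IsNilpotent_subst (hasSubst_cons ha hb) (hH ▸ IsNilpotent.zero)

lemma subst_cons_subst {σ τ : Type*} (H : MvPowerSeries (Fin 2) A) {a b : MvPowerSeries σ A}
    (ha : PowerSeries.HasSubst a) (hb : PowerSeries.HasSubst b) {c : σ → MvPowerSeries τ A}
    (hc : MvPowerSeries.HasSubst c) :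
    MvPowerSeries.subst c (MvPowerSeries.subst ![a, b] H) =
      MvPowerSeries.subst ![MvPowerSeries.subst c a, MvPowerSeries.subst c b] H := by
  rw [MvPowerSeries.subst_comp_subst_apply (hasSubst_cons ha hb) hc]
  congr 1
  ext1 i
  fin_cases i <;> rfl

lemma subst_subst {σ τ : Type*} (f : PowerSeries A) {a : MvPowerSeries σ A}
    (ha : PowerSeries.HasSubst a) {c : σ → MvPowerSeries τ A} (hc : MvPowerSeries.HasSubst c) :
    MvPowerSeries.subst c (PowerSeries.subst a f) =
      PowerSeries.subst (MvPowerSeries.subst c a) f :=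
  MvPowerSeries.subst_comp_subst_apply ha.const hc f

lemma hasSubst_subst {σ : Type*} {f : PowerSeries A} (hf : PowerSeries.constantCoeff f = 0)
    {a : MvPowerSeries σ A} (ha : PowerSeries.HasSubst a) :
    PowerSeries.HasSubst (PowerSeries.subst a f) :=
  MvPowerSeries.IsNilpotent_subst ha.const
    (by rw [← PowerSeries.constantCoeff, hf]; exact IsNilpotent.zero)

lemma coeff_one_subst_cons (H : MvPowerSeries (Fin 2) A) {a b : PowerSeries A}
    (ha : PowerSeries.constantCoeff a = 0) (hb : PowerSeries.constantCoeff b = 0) :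
    PowerSeries.coeff 1 (MvPowerSeries.subst ![a, b] H : PowerSeries A) =
      MvPowerSeries.coeff (Finsupp.single 0 1) H * PowerSeries.coeff 1 a +
      MvPowerSeries.coeff (Finsupp.single 1 1) H * PowerSeries.coeff 1 b := by
  have hs := hasSubst_cons (PowerSeries.HasSubst.of_constantCoeff_zero' ha)
    (PowerSeries.HasSubst.of_constantCoeff_zero' hb)
  have hne : (Finsupp.single 0 1 : Fin 2 →₀ ℕ) ≠ Finsupp.single 1 1 := by
    intro h
    simpa using DFunLike.congr_fun h 0
  rw [PowerSeries.coeff, MvPowerSeries.coeff_subst hs,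
    finsum_eq_sum_of_support_subset (s := {Finsupp.single 0 1, Finsupp.single 1 1})]
  · rw [Finset.sum_pair hne]
    simp
  · intro d hd
    by_contra h
    refine hd ?_
    obtain ⟨a, rfl⟩ := PowerSeries.X_dvd_iff.mpr ha
    obtain ⟨b, rfl⟩ := PowerSeries.X_dvd_iff.mpr hb
    -- A monomial of total degree `e` contributes a multiple of `X ^ e`, so only the two linear
    -- monomials reach degree one.
    have hprod : (d.prod fun s e => ![PowerSeries.X * a, PowerSeries.X * b] s ^ e) =
        PowerSeries.X ^ (d 0 + d 1) * (a ^ d 0 * b ^ d 1) := by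
      rw [Finsupp.prod_fintype _ _ (by simp)]
      simp
      ring
    have hd1 : d 0 + d 1 ≠ 1 := by
      intro h1
      apply h
      have : (d 0 = 1 ∧ d 1 = 0) ∨ (d 0 = 0 ∧ d 1 = 1) := by omega
      rw [Finset.mem_coe, Finset.mem_insert, Finset.mem_singleton]
      rcases this with ⟨h0, h1⟩ | ⟨h0, h1⟩
      · left; ext i; fin_cases i <;> simp [h0, h1]
      · right; ext i; fin_cases i <;> simp [h0, h1]
    have h0 : PowerSeries.coeff 1 (PowerSeries.X ^ (d 0 + d 1) * (a ^ d 0 * b ^ d 1)) = 0 := by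
      rw [PowerSeries.coeff_X_pow_mul']
      split_ifs with h2
      · have h3 : d 0 = 0 := by omega
        have h4 : d 1 = 0 := by omega
        simp [h3, h4, PowerSeries.coeff_one]
      · rfl
    beta_reduce
    rw [hprod]
    exact (congrArg _ h0).trans (smul_zero _)

lemma IsHom.subst_apply {σ : Type*} {F G : FormalGroup A} {f : PowerSeries A} (hf : F.IsHom G f)
    {a b : MvPowerSeries σ A} (ha : PowerSeries.HasSubst a) (hb : PowerSeries.HasSubst b) :
    PowerSeries.subst (MvPowerSeries.subst ![a, b] F.toPowerSeries) f =
      MvPowerSeries.subst ![PowerSeries.subst a f, PowerSeries.subst b f] G.toPowerSeries := by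
  have hab := hasSubst_cons ha hb
  have h := congrArg (MvPowerSeries.subst ![a, b]) hf.subst_eq
  rw [subst_subst _ F.hasSubst_toPowerSeries hab,
    subst_cons_subst _ (hasSubst_subst hf.constantCoeff_eq_zero (.X 0))
      (hasSubst_subst hf.constantCoeff_eq_zero (.X 1)) hab,
    subst_subst _ (.X 0) hab, subst_subst _ (.X 1) hab, MvPowerSeries.subst_X hab,
    MvPowerSeries.subst_X hab] at h
  exact h

lemma constantCoeff_mulSeries (F : FormalGroup A) (m : ℕ) :
    PowerSeries.constantCoeff (F.mulSeries m) = 0 := by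
  induction m with
  | zero => simp [mulSeries]
  | succ m ih =>
    refine MvPowerSeries.constantCoeff_subst_eq_zero
      (hasSubst_cons (PowerSeries.HasSubst.of_constantCoeff_zero' ih) .X') (fun i => ?_)
      F.zero_constantCoeff
    fin_cases i
    · exact ih
    · exact PowerSeries.constantCoeff_X

lemma hasSubst_mulSeries (F : FormalGroup A) (m : ℕ) :
    PowerSeries.HasSubst (F.mulSeries m) :=
  PowerSeries.HasSubst.of_constantCoeff_zero' (F.constantCoeff_mulSeries m)

lemma coeff_one_mulSeries (F : FormalGroup A) (m : ℕ) :
    PowerSeries.coeff 1 (F.mulSeries m) = m := by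
  induction m with
  | zero => simp [mulSeries]
  | succ m ih =>
    rw [mulSeries, coeff_one_subst_cons _ (F.constantCoeff_mulSeries m) (by simp), ih,
      F.lin_coeff_X, F.lin_coeff_Y]
    simp

lemma map_mulSeries {B : Type*} [CommRing B] (F : FormalGroup A) (α : A →+* B) (m : ℕ) :
    (F.map α).mulSeries m = PowerSeries.map α (F.mulSeries m) := by
  induction m with
  | zero => simp [mulSeries]
  | succ m ih =>
    rw [mulSeries, mulSeries, PowerSeries.map,
      MvPowerSeries.map_subst (hasSubst_cons (F.hasSubst_mulSeries m) .X'), ih, map_toPowerSeries]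
    congr 1
    ext1 i
    fin_cases i
    · rfl
    · exact (PowerSeries.map_X α).symm

lemma HasHeight.map {k l : Type*} [Field k] [Field l] {F : FormalGroup k} {p n : ℕ}
    (h : F.HasHeight p n) (hp : p ≠ 0) (α : k →+* l) : (F.map α).HasHeight p n := by
  obtain ⟨g, hg, e⟩ := h
  refine ⟨PowerSeries.map α g, by simpa using hg, ?_⟩
  rw [map_mulSeries, e]
  ext i
  rw [PowerSeries.coeff_map, PowerSeries.coeff_subst_X_pow (pow_ne_zero n hp),
    PowerSeries.coeff_subst_X_pow (pow_ne_zero n hp)]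
  split_ifs <;> simp

lemma IsHom.subst_mulSeries {F G : FormalGroup A} {f : PowerSeries A} (hf : F.IsHom G f) (m : ℕ) :
    PowerSeries.subst (F.mulSeries m) f = PowerSeries.subst f (G.mulSeries m) := by
  induction m with
  | zero =>
    rw [mulSeries, mulSeries, PowerSeries.subst_zero_of_constantCoeff_zero hf.constantCoeff_eq_zero,
      ← PowerSeries.coe_substAlgHom hf.hasSubst, map_zero]
  | succ m ih =>
    rw [mulSeries, mulSeries, hf.subst_apply (F.hasSubst_mulSeries m) .X', ih]
    have := subst_cons_subst G.toPowerSeries (G.hasSubst_mulSeries m) .X' hf.hasSubst.const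
    refine Eq.trans ?_ this.symm
    congr 3
    rw [PowerSeries.X_subst]
    exact (PowerSeries.subst_X hf.hasSubst).symm

/-- Evaluate the identity for `f` at `(g X, g Y)` and apply `g` to both sides. -/
lemma IsHom.inverse {F G : FormalGroup A} {f g : PowerSeries A} (hf : F.IsHom G f)
    (hg : PowerSeries.constantCoeff g = 0) (hfg : PowerSeries.subst g f = PowerSeries.X)
    (hgf : PowerSeries.subst f g = PowerSeries.X) : G.IsHom F g where
  constantCoeff_eq_zero := hg
  subst_eq := by
    have hgs : PowerSeries.HasSubst g := PowerSeries.HasSubst.of_constantCoeff_zero' hg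
    have h0 := hasSubst_subst hg (.X (0 : Fin 2))
    have h1 := hasSubst_subst hg (.X (1 : Fin 2))
    have key := hf.subst_apply h0 h1
    rw [← PowerSeries.subst_comp_subst_apply hgs (.X 0), hfg,
      ← PowerSeries.subst_comp_subst_apply hgs (.X 1), hfg, PowerSeries.subst_X (.X 0),
      PowerSeries.subst_X (.X 1)] at key
    rw [cons_X_X, MvPowerSeries.subst_self, id] at key
    have hs := hasSubst_subst_cons F.zero_constantCoeff h0 h1
    rw [← key, ← PowerSeries.subst_comp_subst_apply hf.hasSubst hs, hgf, PowerSeries.subst_X hs]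

lemma IsHom.isIsom {F G : FormalGroup A} {f : PowerSeries A} (hf : F.IsHom G f)
    (h : IsUnit (PowerSeries.coeff 1 f)) : F.IsIsom G f :=
  ⟨hf, f.substInvOfIsUnit h, hf.inverse (PowerSeries.constantCoeff_substInvOfIsUnit f h)
    (PowerSeries.subst_substInvOfIsUnit_right f hf.constantCoeff_eq_zero h)
    (PowerSeries.subst_substInvOfIsUnit_left f hf.constantCoeff_eq_zero h),
    PowerSeries.subst_substInvOfIsUnit_left f hf.constantCoeff_eq_zero h,
    PowerSeries.subst_substInvOfIsUnit_right f hf.constantCoeff_eq_zero h⟩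

/-! ### Transport of a formal group law along an invertible series. -/

section Conj

variable (F : FormalGroup A) (f g : PowerSeries A)

/-- The power series `f (F (g X, g Y))`. -/
def conjSeries : MvPowerSeries (Fin 2) A :=
  PowerSeries.subst (MvPowerSeries.subst ![
    PowerSeries.subst (MvPowerSeries.X 0 : MvPowerSeries (Fin 2) A) g,
    PowerSeries.subst (MvPowerSeries.X 1 : MvPowerSeries (Fin 2) A) g] F.toPowerSeries) f

variable {f g}

lemma constantCoeff_conjSeries (hf : PowerSeries.constantCoeff f = 0)
    (hg : PowerSeries.constantCoeff g = 0) :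
    MvPowerSeries.constantCoeff (F.conjSeries f g) = 0 := by
  refine PowerSeries.constantCoeff_subst_eq_zero ?_ f hf
  refine MvPowerSeries.constantCoeff_subst_eq_zero (hasSubst_pair hg) (fun i => ?_)
    F.zero_constantCoeff
  fin_cases i
  · exact PowerSeries.constantCoeff_subst_eq_zero (by simp) g hg
  · exact PowerSeries.constantCoeff_subst_eq_zero (by simp) g hg

lemma subst_conjSeries {σ : Type*} (hg : PowerSeries.constantCoeff g = 0)
    {a b : MvPowerSeries σ A} (ha : PowerSeries.HasSubst a) (hb : PowerSeries.HasSubst b) :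
    MvPowerSeries.subst ![a, b] (F.conjSeries f g) =
      PowerSeries.subst (MvPowerSeries.subst ![PowerSeries.subst a g, PowerSeries.subst b g]
        F.toPowerSeries) f := by
  have hab := hasSubst_cons ha hb
  have h0 := hasSubst_subst hg (.X (0 : Fin 2))
  have h1 := hasSubst_subst hg (.X (1 : Fin 2))
  rw [conjSeries, subst_subst _ (hasSubst_subst_cons F.zero_constantCoeff h0 h1) hab,
    subst_cons_subst _ h0 h1 hab, subst_subst _ (.X 0) hab, subst_subst _ (.X 1) hab,
    MvPowerSeries.subst_X hab, MvPowerSeries.subst_X hab]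
  rfl

/-- The inner `g` cancels the outer `f`; nested conjugates thus telescope, which reduces
associativity of the conjugate to that of `F`. -/
lemma subst_conjSeries' {σ : Type*} (hf : PowerSeries.constantCoeff f = 0)
    (hg : PowerSeries.constantCoeff g = 0) (hgf : PowerSeries.subst f g = PowerSeries.X)
    {a b : MvPowerSeries σ A} (ha : PowerSeries.HasSubst a) (hb : PowerSeries.HasSubst b) :
    PowerSeries.subst (MvPowerSeries.subst ![a, b] (F.conjSeries f g)) g =
      MvPowerSeries.subst ![PowerSeries.subst a g, PowerSeries.subst b g] F.toPowerSeries := by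
  have hs := hasSubst_subst_cons F.zero_constantCoeff (hasSubst_subst hg ha) (hasSubst_subst hg hb)
  rw [F.subst_conjSeries hg ha hb, ← PowerSeries.subst_comp_subst_apply
    (PowerSeries.HasSubst.of_constantCoeff_zero' hf) hs, hgf, PowerSeries.subst_X hs]

/-- The conjugate `f (F (g X, g Y))` of a formal group law `F` by a power series `f` with
compositional inverse `g`. -/
def conj (hf : PowerSeries.constantCoeff f = 0) (hg : PowerSeries.constantCoeff g = 0)
    (hfg : PowerSeries.subst g f = PowerSeries.X) (hgf : PowerSeries.subst f g = PowerSeries.X) :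
    FormalGroup A where
  toPowerSeries := F.conjSeries f g
  zero_constantCoeff := F.constantCoeff_conjSeries hf hg
  lin_coeff_X := by
    -- Restricting to `Y = 0` turns the conjugate into `f (g X) = X`, from which the linear
    -- coefficient is read off.
    have h := coeff_one_subst_cons (F.conjSeries f g) (a := PowerSeries.X) (b := 0) (by simp)
      (by simp)
    have hz : PowerSeries.subst (0 : PowerSeries A) g = 0 :=
      PowerSeries.subst_zero_of_constantCoeff_zero hg
    have h' := F.subst_conjSeries (f := f) hg (PowerSeries.HasSubst.X' (R := A)) (.zero')
    rw [hz, PowerSeries.X_subst, F.add_zero (PowerSeries.HasSubst.of_constantCoeff_zero' hg),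
      hfg] at h'
    rw [h'] at h
    simpa using h.symm
  lin_coeff_Y := by
    have h := coeff_one_subst_cons (F.conjSeries f g) (a := 0) (b := PowerSeries.X) (by simp)
      (by simp)
    have hz : PowerSeries.subst (0 : PowerSeries A) g = 0 :=
      PowerSeries.subst_zero_of_constantCoeff_zero hg
    have h' := F.subst_conjSeries (f := f) hg (.zero') (PowerSeries.HasSubst.X' (R := A))
    rw [hz, PowerSeries.X_subst, F.zero_add (PowerSeries.HasSubst.of_constantCoeff_zero' hg),
      hfg] at h'
    rw [h'] at h
    simpa using h.symm
  assoc := by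
    have hc := F.constantCoeff_conjSeries hf hg
    have h0 := PowerSeries.HasSubst.X (S := A) (0 : Fin 3)
    have h1 := PowerSeries.HasSubst.X (S := A) (1 : Fin 3)
    have h2 := PowerSeries.HasSubst.X (S := A) (2 : Fin 3)
    rw [F.subst_conjSeries hg (hasSubst_subst_cons hc h0 h1) h2,
      F.subst_conjSeries hg h0 (hasSubst_subst_cons hc h1 h2),
      F.subst_conjSeries' hf hg hgf h0 h1, F.subst_conjSeries' hf hg hgf h1 h2,
      F.assoc' (hasSubst_subst hg h0) (hasSubst_subst hg h1) (hasSubst_subst hg h2)]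

variable (hf : PowerSeries.constantCoeff f = 0) (hg : PowerSeries.constantCoeff g = 0)
  (hfg : PowerSeries.subst g f = PowerSeries.X) (hgf : PowerSeries.subst f g = PowerSeries.X)

lemma conj_isComm [F.IsComm] : (F.conj hf hg hfg hgf).IsComm where
  comm := by
    change F.conjSeries f g = MvPowerSeries.subst _ (F.conjSeries f g)
    rw [F.subst_conjSeries hg (.X 1) (.X 0),
      F.comm' (hasSubst_subst hg (.X 1)) (hasSubst_subst hg (.X 0))]
    rfl

lemma isHom_conj : F.IsHom (F.conj hf hg hfg hgf) f where
  constantCoeff_eq_zero := hf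
  subst_eq := by
    have hfs : PowerSeries.HasSubst f := PowerSeries.HasSubst.of_constantCoeff_zero' hf
    change _ = MvPowerSeries.subst _ (F.conjSeries f g)
    rw [F.subst_conjSeries hg (hasSubst_subst hf (.X 0)) (hasSubst_subst hf (.X 1)),
      ← PowerSeries.subst_comp_subst_apply hfs (.X 0), hgf,
      ← PowerSeries.subst_comp_subst_apply hfs (.X 1), hgf, PowerSeries.subst_X (.X 0),
      PowerSeries.subst_X (.X 1)]
    rw [cons_X_X, MvPowerSeries.subst_self, id]

end Conj

/-- The target of an invertible homomorphism is determined by its source. -/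
lemma IsHom.target_unique {F G H : FormalGroup A} {f g : PowerSeries A} (hG : F.IsHom G f)
    (hH : F.IsHom H f) (hg : PowerSeries.constantCoeff g = 0)
    (hfg : PowerSeries.subst g f = PowerSeries.X) : G = H := by
  have hgs : PowerSeries.HasSubst g := PowerSeries.HasSubst.of_constantCoeff_zero' hg
  have h0 := hasSubst_subst hg (.X (0 : Fin 2))
  have h1 := hasSubst_subst hg (.X (1 : Fin 2))
  have key := (hG.subst_apply h0 h1).symm.trans (hH.subst_apply h0 h1)
  rw [← PowerSeries.subst_comp_subst_apply hgs (.X 0), hfg,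
    ← PowerSeries.subst_comp_subst_apply hgs (.X 1), hfg, PowerSeries.subst_X (.X 0),
    PowerSeries.subst_X (.X 1), cons_X_X, MvPowerSeries.subst_self, id, id] at key
  exact FormalGroup.ext key

end FormalGroup

/-! ### Rigidity of homomorphisms at finite height. -/

namespace PowerSeries

variable {A : Type*} [CommRing A]

lemma finsum_mem_ideal {ι : Sort*} {I : Ideal A} {u : ι → A} (h : ∀ i, u i ∈ I) :
    ∑ᶠ i, u i ∈ I :=
  finsum_induction (· ∈ I) (zero_mem I) (fun _ _ => add_mem) h

lemma coeff_sub_pow_mem {I : Ideal A} {f f' : PowerSeries A} (h : ∀ i, coeff i (f - f') ∈ I)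
    (d : ℕ) : ∀ i, coeff i (f ^ d - f' ^ d) ∈ I := by
  obtain ⟨q, hq⟩ := sub_dvd_pow_sub_pow f f' d
  rw [hq]
  exact coeff_mul_mem_ideal_of_coeff_left_mem_ideal' h

/-- Expanding around `f'`, the term linear in `f - f'` carries the factor `p`, and the others
contain `f - f'` twice. -/
lemma coeff_sub_pow_mem_mul {I M : Ideal A} (hIM : I ≤ M) {p : ℕ} (hp : (p : A) ∈ M)
    {f f' : PowerSeries A} (h : ∀ i, coeff i (f - f') ∈ I) :
    ∀ i, coeff i (f ^ p - f' ^ p) ∈ I * M := by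
  obtain ⟨k, hk⟩ := Polynomial.powAddExpansion f' (f - f') p
  have e : f ^ p - f' ^ p = (f - f') * (C (p : A) * f' ^ (p - 1) + k * (f - f')) := by
    rw [add_sub_cancel] at hk
    rw [hk, map_natCast]
    ring
  rw [e]
  refine coeff_mul_mem_ideal_mul_ideal_of_coeff_mem_ideal' h fun i => ?_
  rw [map_add]
  refine add_mem ?_ (hIM (coeff_mul_mem_ideal_of_coeff_right_mem_ideal' h i))
  rw [coeff_C_mul]
  exact Ideal.mul_mem_right _ _ hp

/-- If `P` is modulo `M` a power series in `X ^ p`, then `P ∘ f` modulo `I M` depends on `f`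
modulo `I` only. -/
lemma coeff_subst_sub_subst_mem {I M : Ideal A} (hIM : I ≤ M) {p : ℕ} (hp : (p : A) ∈ M)
    {f f' P : PowerSeries A} (hf : HasSubst f) (hf' : HasSubst f')
    (h : ∀ i, coeff i (f - f') ∈ I) (hP : ∀ i, ¬ p ∣ i → coeff i P ∈ M) (i : ℕ) :
    coeff i (subst f P - subst f' P) ∈ I * M := by
  rw [map_sub, coeff_subst' hf, coeff_subst' hf',
    ← finsum_sub_distrib (coeff_subst_finite' hf P i) (coeff_subst_finite' hf' P i)]
  refine finsum_mem_ideal fun d => ?_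
  rw [← smul_sub, ← map_sub, smul_eq_mul]
  -- The extra factor from `M` comes from the `p`-th power when `p ∣ d`, and from the coefficient of
  -- `P` otherwise.
  by_cases hd : p ∣ d
  · obtain ⟨e, rfl⟩ := hd
    rw [pow_mul, pow_mul]
    exact Ideal.mul_mem_left _ _ (coeff_sub_pow_mem (coeff_sub_pow_mem_mul hIM hp h) e i)
  · rw [mul_comm I]
    exact Ideal.mul_mem_mul (hP d hd) (coeff_sub_pow_mem h d i)

/-- If `U` reduces to a nonzero power series without constant term, then `δ ∘ U` determines `δ`
modulo `I 𝔪`. -/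
lemma coeff_mem_of_coeff_subst_mem [IsLocalRing A] {I : Ideal A} {δ U : PowerSeries A}
    (hU : HasSubst U) {q : ℕ} {W : PowerSeries (ResidueField A)} (hW : constantCoeff W ≠ 0)
    (hUW : map (residue A) U = X ^ q * W) (hq : 0 < q) (hδ : ∀ i, coeff i δ ∈ I)
    (h : ∀ i, coeff i (subst U δ) ∈ I * maximalIdeal A) (i : ℕ) :
    coeff i δ ∈ I * maximalIdeal A := by
  have hc (i d : ℕ) : residue A (coeff (q * i) (U ^ d)) =
      coeff (q * i) (X ^ (q * d) * W ^ d : PowerSeries (ResidueField A)) := by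
    rw [← coeff_map, map_pow, hUW, mul_pow, pow_mul]
  induction i using Nat.strong_induction_on with
  | _ i ih =>
    -- In degree `q * i` the terms `d < i` are handled by induction. For `d > i`, the series `U ^ d`
    -- vanishes modulo `𝔪` below degree `q * d`. For `d = i` the factor is a unit, reducing to the
    -- `i`-th power of the constant term of `W`.
    have hi := h (q * i)
    rw [coeff_subst' hU, ← add_finsum_cond_ne i (coeff_subst_finite' hU δ (q * i))] at hi
    have hrest : ∑ᶠ (d) (_ : d ≠ i), coeff d δ • coeff (q * i) (U ^ d) ∈ I * maximalIdeal A := by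
      refine finsum_mem_ideal fun d => finsum_mem_ideal fun hd => ?_
      rw [smul_eq_mul]
      obtain hlt | hgt := lt_or_gt_of_ne hd
      · exact Ideal.mul_mem_right _ _ (ih d hlt)
      · refine Ideal.mul_mem_mul (hδ d) ?_
        rw [← residue_eq_zero_iff, hc, coeff_X_pow_mul',
          if_neg (not_le.mpr (Nat.mul_lt_mul_of_pos_left hgt hq))]
    have hmain := (Submodule.add_mem_iff_left _ hrest).mp hi
    have hu : IsUnit (coeff (q * i) (U ^ i)) := by
      rw [← residue_ne_zero_iff_isUnit, hc, coeff_X_pow_mul', if_pos le_rfl, Nat.sub_self]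
      simpa using pow_ne_zero i hW
    rwa [smul_eq_mul, mul_comm (coeff i δ), Ideal.unit_mul_mem_iff_mem _ hu] at hmain

end PowerSeries

namespace FormalGroup

variable {A : Type*} [CommRing A] [IsLocalRing A]

/-- The linear coefficient of `[p]` is `p = 0`, whereas height zero would make it nonzero. -/
lemma HasHeight.ne_zero {k : Type*} [Field k] {F : FormalGroup k} {p n : ℕ} [CharP k p]
    (h : F.HasHeight p n) : n ≠ 0 := by
  rintro rfl
  obtain ⟨g, hg, e⟩ := h
  have := F.coeff_one_mulSeries p
  rw [e, pow_zero, pow_one, PowerSeries.X_subst, CharP.cast_eq_zero] at this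
  exact hg this

/-- A homomorphism of formal group laws over a local ring is determined by its reduction, when
the reductions of source and target have finite height. -/
theorem IsHom.eq_of_map_residue_eq [IsHausdorff (maximalIdeal A) A] {p n : ℕ} (hp : p.Prime)
    [CharP (ResidueField A) p] {F G : FormalGroup A}
    (hF : (F.map (residue A)).HasHeight p n) (hG : (G.map (residue A)).HasHeight p n)
    {f f' : PowerSeries A} (hf : F.IsHom G f) (hf' : F.IsHom G f')
    (h : PowerSeries.map (residue A) f = PowerSeries.map (residue A) f') : f = f' := by
  have hn : n ≠ 0 := hF.ne_zero
  have hpn : p ^ n ≠ 0 := pow_ne_zero n hp.ne_zero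
  have hpm : (p : A) ∈ maximalIdeal A := by
    rw [← residue_eq_zero_iff, map_natCast, CharP.cast_eq_zero]
  have hP (i : ℕ) (hi : ¬ p ∣ i) : PowerSeries.coeff i (G.mulSeries p) ∈ maximalIdeal A := by
    obtain ⟨g, -, e⟩ := hG
    rw [← residue_eq_zero_iff, ← PowerSeries.coeff_map, ← map_mulSeries, e,
      PowerSeries.coeff_subst_X_pow hpn, if_neg fun hd => hi ((dvd_pow_self p hn).trans hd)]
  obtain ⟨g, hg, e⟩ := hF
  have hg0 : PowerSeries.constantCoeff g = 0 := by
    have h0 := (F.map (residue A)).constantCoeff_mulSeries p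
    rwa [e, PowerSeries.constantCoeff_subst_X_pow hpn] at h0
  -- Hence `[p]` reduces to `X ^ (p ^ n)` times a series with constant term `g'(0) ≠ 0`.
  obtain ⟨W, rfl⟩ := PowerSeries.X_dvd_iff.mpr hg0
  have hX : PowerSeries.HasSubst (PowerSeries.X ^ p ^ n : PowerSeries (ResidueField A)) :=
    .X_pow hpn
  rw [PowerSeries.subst_mul hX, PowerSeries.subst_X hX, map_mulSeries] at e
  have hW : PowerSeries.constantCoeff
      (PowerSeries.subst (PowerSeries.X ^ p ^ n : PowerSeries (ResidueField A)) W) ≠ 0 := by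
    rw [PowerSeries.constantCoeff_subst_X_pow hpn]
    simpa [PowerSeries.coeff_succ_X_mul] using hg
  have key (r : ℕ) : ∀ i, PowerSeries.coeff i (f - f') ∈ maximalIdeal A ^ (r + 1) := by
    induction r with
    | zero =>
      intro i
      rw [_root_.zero_add, pow_one, ← residue_eq_zero_iff, ← PowerSeries.coeff_map, map_sub, h,
        sub_self, map_zero]
    | succ r ih =>
      rw [pow_succ]
      refine PowerSeries.coeff_mem_of_coeff_subst_mem (F.hasSubst_mulSeries p) hW e
        (Nat.pos_of_ne_zero hpn) ih fun i => ?_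
      -- With `δ = f - f'`, this is `δ ∘ [p]_F = [p]_G ∘ f - [p]_G ∘ f'`; the subtraction is that of
      -- power series, not of the group law.
      rw [PowerSeries.subst_sub (F.hasSubst_mulSeries p), hf.subst_mulSeries, hf'.subst_mulSeries]
      exact PowerSeries.coeff_subst_sub_subst_mem (Ideal.pow_le_self r.succ_ne_zero) hpm
        hf.hasSubst hf'.hasSubst ih hP i
  rw [← sub_eq_zero]
  ext i
  refine IsHausdorff.haus (I := maximalIdeal A) inferInstance _ fun r => ?_
  rw [SModEq.zero, smul_eq_mul, Ideal.mul_top]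
  exact Ideal.pow_le_pow_right r.le_succ (key r i)

end FormalGroup

/-! ### Base change and `*`-isomorphisms. -/

namespace FormalGroup

variable {A B : Type*} [CommRing A] [CommRing B]

lemma map_map {D : Type*} [CommRing D] (F : FormalGroup A) (α : A →+* B) (β : B →+* D) :
    (F.map α).map β = F.map (β.comp α) := by
  ext1
  simp [MvPowerSeries.map_map]

lemma isComm_map (F : FormalGroup A) [F.IsComm] (α : A →+* B) : (F.map α).IsComm where
  comm := by
    have h := congrArg (MvPowerSeries.map α) (IsComm.comm (F := F))
    rw [MvPowerSeries.map_subst .X_X] at h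
    rw [map_toPowerSeries]
    refine h.trans ?_
    congr 1
    ext1 i
    fin_cases i <;> simp

end FormalGroup

lemma IsLocalRing.isUnit_of_residue_ne_zero {A : Type*} [CommRing A] [IsLocalRing A] {a : A}
    (h : residue A a ≠ 0) : IsUnit a :=
  residue_ne_zero_iff_isUnit a |>.mp h

lemma StarIsomorphic.refl {A : Type*} [CommRing A] [IsLocalRing A] (G : FormalGroup A) :
    StarIsomorphic G G :=
  ⟨PowerSeries.X, G.isHom_id.isIsom (by simp), PowerSeries.map_X _⟩

/-- Homomorphisms with equal invertible reduction and the same source have `*`-isomorphic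
targets. -/
lemma FormalGroup.IsHom.starIsomorphic {A : Type*} [CommRing A] [IsLocalRing A]
    {F G₁ G₂ : FormalGroup A} {f₁ f₂ : PowerSeries A} (h₁ : F.IsHom G₁ f₁) (h₂ : F.IsHom G₂ f₂)
    (hu : IsUnit (PowerSeries.coeff 1 f₂))
    (h : PowerSeries.map (residue A) f₁ = PowerSeries.map (residue A) f₂) :
    StarIsomorphic G₂ G₁ := by
  obtain ⟨-, g, hg, hgf, hfg⟩ := h₂.isIsom hu
  have hred : PowerSeries.map (residue A) (PowerSeries.subst g f₁) = PowerSeries.X := by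
    have e₁ : PowerSeries.map (residue A) (PowerSeries.subst g f₁) = _ :=
      PowerSeries.map_subst hg.hasSubst f₁
    have e₂ : PowerSeries.map (residue A) (PowerSeries.subst g f₂) = _ :=
      PowerSeries.map_subst hg.hasSubst f₂
    rw [e₁, h, ← e₂, hfg, PowerSeries.map_X]
  refine ⟨PowerSeries.subst g f₁, (h₁.comp hg).isIsom (isUnit_of_residue_ne_zero ?_), hred⟩
  rw [← PowerSeries.coeff_map, hred, PowerSeries.coeff_one_X]
  exact one_ne_zero

lemma PowerSeries.exists_map_residue_eq {A : Type*} [CommRing A] [IsLocalRing A]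
    {f₀ : PowerSeries (ResidueField A)} (h : constantCoeff f₀ = 0) :
    ∃ f : PowerSeries A, constantCoeff f = 0 ∧ map (residue A) f = f₀ := by
  choose c hc using fun i => residue_surjective (R := A) (coeff i f₀)
  -- An arbitrary lift would only have constant term in `𝔪`; it is set to zero exactly.
  refine ⟨mk fun i => if i = 0 then 0 else c i, by simp [← coeff_zero_eq_constantCoeff_apply], ?_⟩
  ext i
  rw [coeff_map, coeff_mk]
  split_ifs with hi
  · rw [hi, map_zero, coeff_zero_eq_constantCoeff_apply, h]
  · exact hc i

/-! ### Existence and uniqueness of lifts to universal deformations. -/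

section Lift

universe u

variable {R : Type u} [CommRing R] [IsLocalRing R] {m : ℕ}

/-- The universal property for deformations along an arbitrary local homomorphism `R → A`. -/
lemma IsUniversalDeformation.existsUnique_ringHom {G : FormalGroup (ResidueField R)}
    {Gt : FormalGroup (MvPowerSeries (Fin m) R)} (hGt : IsUniversalDeformation G Gt)
    {A : Type u} [CommRing A] [IsLocalRing A] [IsNoetherianRing A] [IsAdicComplete (maximalIdeal A) A]
    (ρ : R →+* A) [hρ : IsLocalHom ρ] (G' : FormalGroup A) (hc : G'.IsComm)
    (hG' : G.map (ResidueField.map ρ) = G'.map (residue A)) :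
    ∃! β : MvPowerSeries (Fin m) R →+* A, β.comp MvPowerSeries.C = ρ ∧ IsLocalHom β ∧
      StarIsomorphic (Gt.map β) G' := by
  -- The `R`-algebra structure is free to choose; later `ρ` is the canonical inclusion precomposed
  -- with `α`.
  let : Algebra R A := ρ.toAlgebra
  have : IsLocalHom (algebraMap R A) := hρ
  obtain ⟨a, ha, hu⟩ := hGt.existsUnique A G' ⟨hc, hG'⟩
  refine ⟨a, ⟨RingHom.ext fun r => a.commutes r, ha⟩, fun β hβ => ?_⟩
  let b : MvPowerSeries (Fin m) R →ₐ[R] A :=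
    { β with commutes' := fun r => RingHom.congr_fun hβ.1 r }
  rw [← hu b hβ.2]
  rfl

/-- `φ` induces `φ₀` on residue fields and its homomorphism of rings restricts to `α`. -/
def FGLHom.IsLift {F G : FormalGroup (ResidueField R)}
    {Ft Gt : FormalGroup (MvPowerSeries (Fin m) R)} (φ₀ : FGLHom F G) (α : R →+* R)
    (φ : FGLHom Ft Gt) : Prop :=
  φ.InducesOnResidueField φ₀ ∧
    (MvPowerSeries.C : R →+* MvPowerSeries (Fin m) R).comp α =
      φ.ringHom.comp (MvPowerSeries.C : R →+* MvPowerSeries (Fin m) R)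

lemma residueField_map_comp_eq {A : Type*} [CommRing A] [IsLocalRing A] (ι : R →+* A)
    [IsLocalHom ι] {α : R →+* R} [IsLocalHom α] {a : ResidueField R →+* ResidueField R}
    (hα : ∀ r, a (residue R r) = residue R (α r)) :
    ResidueField.map (ι.comp α) = (ResidueField.map ι).comp a := by
  refine RingHom.ext fun x => ?_
  obtain ⟨r, rfl⟩ := residue_surjective x
  simp [hα, ResidueField.map_residue]

variable {F G : FormalGroup (ResidueField R)} {Ft Gt : FormalGroup (MvPowerSeries (Fin m) R)}
  {φ₀ : FGLHom F G} {α : R →+* R}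

/-- The reduction of the target is a base change of `G` determined by `φ₀`; so the target has the
height of `G` and can itself be fed to the universal property. -/
lemma FGLHom.IsLift.map_residue_target {φ : FGLHom Ft Gt} (h : FGLHom.IsLift φ₀ α φ)
    (hGt : IsDeformation (A := MvPowerSeries (Fin m) R) G Gt) :
    (Gt.map φ.ringHom).map (residue (MvPowerSeries (Fin m) R)) =
      G.map ((ResidueField.map (algebraMap R (MvPowerSeries (Fin m) R))).comp φ₀.ringHom) := by
  obtain ⟨⟨_, hr, -⟩, -⟩ := h
  rw [← hr, ← FormalGroup.map_map, hGt.map_eq, FormalGroup.map_map, FormalGroup.map_map]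
  rfl

lemma FGLHom.IsLift.isUnit_coeff_one {φ : FGLHom Ft Gt} (h : FGLHom.IsLift φ₀ α φ)
    (hu : IsUnit (PowerSeries.coeff 1 φ₀.series)) : IsUnit (PowerSeries.coeff 1 φ.series) := by
  obtain ⟨⟨_, -, hs⟩, -⟩ := h
  refine isUnit_of_residue_ne_zero ?_
  rw [← PowerSeries.coeff_map, hs, PowerSeries.coeff_map]
  exact (hu.map _).ne_zero

lemma FGLHom.isLift_id :
    FGLHom.IsLift (FGLHom.id F) (RingHom.id R) (FGLHom.id Ft) := by
  refine ⟨⟨isLocalHom_id (MvPowerSeries (Fin m) R), ?_, ?_⟩, rfl⟩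
  · refine RingHom.ext fun x => ?_
    obtain ⟨r, rfl⟩ := residue_surjective x
    rfl
  · simp [FGLHom.id]

lemma FGLHom.IsLift.comp {H : FormalGroup (ResidueField R)}
    {Ht : FormalGroup (MvPowerSeries (Fin m) R)}
    {ψ₀ : FGLHom G H} {α' : R →+* R} {φ : FGLHom Ft Gt} {ψ : FGLHom Gt Ht}
    (hψ : FGLHom.IsLift ψ₀ α' ψ) (hφ : FGLHom.IsLift φ₀ α φ) :
    FGLHom.IsLift (ψ₀.comp φ₀) (α.comp α') (ψ.comp φ) := by
  obtain ⟨⟨hl, hr, hs⟩, hC⟩ := hφ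
  obtain ⟨⟨hl', hr', hs'⟩, hC'⟩ := hψ
  have hloc : IsLocalHom (ψ.comp φ).ringHom := RingHom.isLocalHom_comp φ.ringHom ψ.ringHom
  refine ⟨⟨hloc, ?_, ?_⟩, ?_⟩
  · have e : ResidueField.map (ψ.comp φ).ringHom =
        (ResidueField.map φ.ringHom).comp (ResidueField.map ψ.ringHom) :=
      ResidueField.map_comp ψ.ringHom φ.ringHom
    rw [e, RingHom.comp_assoc, hr', ← RingHom.comp_assoc, hr]
    rfl
  · have e₁ : PowerSeries.map (residue (MvPowerSeries (Fin m) R)) (ψ.comp φ).series = _ :=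
      PowerSeries.map_subst φ.isHom.hasSubst (PowerSeries.map φ.ringHom ψ.series)
    have e₂ : PowerSeries.map (ResidueField.map (algebraMap R (MvPowerSeries (Fin m) R)))
        (ψ₀.comp φ₀).series = _ :=
      PowerSeries.map_subst φ₀.isHom.hasSubst (PowerSeries.map φ₀.ringHom ψ₀.series)
    -- `e₃` and `e₄` move reduction and base change from `k` past the twist of the outer series by
    -- the ring map of `φ`.
    have e₃ : PowerSeries.map (residue (MvPowerSeries (Fin m) R))
          (PowerSeries.map φ.ringHom ψ.series) =
        PowerSeries.map (ResidueField.map φ.ringHom)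
          (PowerSeries.map (residue (MvPowerSeries (Fin m) R)) ψ.series) := by
      ext i
      simp [ResidueField.map_residue]
    have e₄ : PowerSeries.map (ResidueField.map φ.ringHom)
          (PowerSeries.map (ResidueField.map (algebraMap R (MvPowerSeries (Fin m) R))) ψ₀.series) =
        PowerSeries.map (ResidueField.map (algebraMap R (MvPowerSeries (Fin m) R)))
          (PowerSeries.map φ₀.ringHom ψ₀.series) := by
      ext i
      simpa using RingHom.congr_fun hr (PowerSeries.coeff i ψ₀.series)
    rw [e₁, e₂, ← e₄, ← hs', ← e₃]
    exact congrArg (PowerSeries.subst · _) hs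
  · change _ = (φ.ringHom.comp ψ.ringHom).comp _
    rw [RingHom.comp_assoc, ← hC', ← RingHom.comp_assoc, hC, RingHom.comp_assoc]

variable [IsNoetherianRing R] [IsAdicComplete (maximalIdeal R) R] [IsLocalHom α]

theorem FGLHom.exists_isLift (hFt : IsDeformation (A := MvPowerSeries (Fin m) R) F Ft)
    (hGt : IsUniversalDeformation G Gt)
    (hu : IsUnit (PowerSeries.coeff 1 φ₀.series))
    (hα : ∀ r, φ₀.ringHom (residue R r) = residue R (α r)) :
    ∃ φ : FGLHom Ft Gt, FGLHom.IsLift φ₀ α φ := by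
  have := MvPowerSeries.isAdicComplete_maximalIdeal R m
  have := hFt.isComm
  have hρ := residueField_map_comp_eq (algebraMap R (MvPowerSeries (Fin m) R)) hα
  have hφ₀ := φ₀.isHom.map (ResidueField.map (algebraMap R (MvPowerSeries (Fin m) R)))
  rw [hFt.map_eq, FormalGroup.map_map, ← hρ] at hφ₀
  obtain ⟨f, hf, hfr⟩ := PowerSeries.exists_map_residue_eq hφ₀.constantCoeff_eq_zero
  have hfu : IsUnit (PowerSeries.coeff 1 f) := by
    refine isUnit_of_residue_ne_zero ?_
    rw [← PowerSeries.coeff_map, hfr, PowerSeries.coeff_map]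
    exact (hu.map _).ne_zero
  let g := f.substInvOfIsUnit hfu
  have hg : PowerSeries.constantCoeff g = 0 := PowerSeries.constantCoeff_substInvOfIsUnit f hfu
  have hfg : PowerSeries.subst g f = PowerSeries.X :=
    PowerSeries.subst_substInvOfIsUnit_right f hf hfu
  have hgf : PowerSeries.subst f g = PowerSeries.X :=
    PowerSeries.subst_substInvOfIsUnit_left f hf hfu
  have hconj := Ft.isHom_conj hf hg hfg hgf
  have hred : G.map (ResidueField.map ((algebraMap R (MvPowerSeries (Fin m) R)).comp α)) =
      (Ft.conj hf hg hfg hgf).map (residue (MvPowerSeries (Fin m) R)) := by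
    rw [← hfr] at hφ₀
    have e : PowerSeries.map (residue (MvPowerSeries (Fin m) R)) (PowerSeries.subst g f) = _ :=
      PowerSeries.map_subst (PowerSeries.HasSubst.of_constantCoeff_zero' hg) f
    rw [hfg, PowerSeries.map_X] at e
    -- Both laws are targets of the same invertible series out of the reduction of `Ft`.
    refine hφ₀.target_unique (hconj.map (residue (MvPowerSeries (Fin m) R)))
      (g := PowerSeries.map (residue (MvPowerSeries (Fin m) R)) g) ?_ e.symm
    rw [← PowerSeries.coeff_zero_eq_constantCoeff_apply, PowerSeries.coeff_map,
      PowerSeries.coeff_zero_eq_constantCoeff_apply, hg, map_zero]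
  obtain ⟨β, ⟨hβ, hloc, w, ⟨hw, v, hv, hwv, -⟩, hwr⟩, -⟩ := hGt.existsUnique_ringHom
    ((algebraMap R (MvPowerSeries (Fin m) R)).comp α) _ (Ft.conj_isComm hf hg hfg hgf) hred
  have hvr : PowerSeries.map (residue (MvPowerSeries (Fin m) R)) v = PowerSeries.X := by
    have e : PowerSeries.map (residue (MvPowerSeries (Fin m) R)) (PowerSeries.subst w v) = _ :=
      PowerSeries.map_subst hw.hasSubst v
    have e' : PowerSeries.X =
        PowerSeries.subst (PowerSeries.map (residue (MvPowerSeries (Fin m) R)) w)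
          (PowerSeries.map (residue (MvPowerSeries (Fin m) R)) v) := by
      rwa [hwv, PowerSeries.map_X] at e
    rw [hwr, PowerSeries.X_subst] at e'
    exact e'.symm
  -- `v` runs from the conjugate to `β^* Gt` and reduces to `X`, so composing with it leaves the
  -- reduction of `f` unchanged.
  refine ⟨⟨PowerSeries.subst f v, β, hv.comp hconj⟩, ⟨hloc, ?_, ?_⟩, hβ.symm⟩
  · rw [← hρ, ← ResidueField.map_comp]
    congr 1
  · have e : PowerSeries.map (residue (MvPowerSeries (Fin m) R)) (PowerSeries.subst f v) = _ :=
      PowerSeries.map_subst hconj.hasSubst v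
    refine e.trans ?_
    rw [hvr]
    exact (PowerSeries.subst_X (hconj.map (residue (MvPowerSeries (Fin m) R))).hasSubst).trans hfr

theorem FGLHom.IsLift.unique {p n : ℕ} (hp : p.Prime) [CharP (ResidueField R) p]
    (hF : F.HasHeight p n) (hG : G.HasHeight p n)
    (hFt : IsDeformation (A := MvPowerSeries (Fin m) R) F Ft) (hGt : IsUniversalDeformation G Gt)
    (hu : IsUnit (PowerSeries.coeff 1 φ₀.series))
    (hα : ∀ r, φ₀.ringHom (residue R r) = residue R (α r)) {φ₁ φ₂ : FGLHom Ft Gt}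
    (h₁ : FGLHom.IsLift φ₀ α φ₁) (h₂ : FGLHom.IsLift φ₀ α φ₂) : φ₁ = φ₂ := by
  have := MvPowerSeries.isAdicComplete_maximalIdeal R m
  have := hGt.isDeformation.isComm
  have : CharP (ResidueField (MvPowerSeries (Fin m) R)) p :=
    charP_of_injective_ringHom (ResidueField.map (algebraMap R (MvPowerSeries (Fin m) R))).injective
      p
  have hρ := residueField_map_comp_eq (algebraMap R (MvPowerSeries (Fin m) R)) hα
  have ht := h₁.map_residue_target hGt.isDeformation
  have hs : PowerSeries.map (residue (MvPowerSeries (Fin m) R)) φ₁.series =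
      PowerSeries.map (residue (MvPowerSeries (Fin m) R)) φ₂.series :=
    h₁.1.choose_spec.2.trans h₂.1.choose_spec.2.symm
  have hβ : φ₁.ringHom = φ₂.ringHom := by
    -- The deformation being classified is the pullback of `Gt` along the first ring map, which that
    -- map classifies trivially.
    refine (hGt.existsUnique_ringHom ((algebraMap R (MvPowerSeries (Fin m) R)).comp α)
      (Gt.map φ₁.ringHom) (Gt.isComm_map _) ?_).unique
      ⟨h₁.2.symm, h₁.1.choose, StarIsomorphic.refl _⟩
      ⟨h₂.2.symm, h₂.1.choose,
        φ₁.isHom.starIsomorphic φ₂.isHom (h₂.isUnit_coeff_one hu) hs⟩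
    rw [ht, hρ]
  refine FGLHom.ext ?_ hβ
  -- With the ring maps equal, both series have the same target, and finite height applies.
  refine φ₁.isHom.eq_of_map_residue_eq hp (n := n) ?_ ?_ (hβ ▸ φ₂.isHom) hs
  · rw [← hFt.map_eq]
    exact hF.map hp.ne_zero _
  · rw [ht]
    exact hG.map hp.ne_zero _

end Lift

/-! ### Assembling the isomorphism. -/

lemma FGLHom.isUnit_coeff_one_of_comp_eq_id {A B : Type*} [CommRing A] [CommRing B]
    {F : FormalGroup A} {G : FormalGroup B} {φ : FGLHom F G} {ψ : FGLHom G F}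
    (h : ψ.comp φ = FGLHom.id F) : IsUnit (PowerSeries.coeff 1 φ.series) := by
  have e : PowerSeries.subst φ.series (PowerSeries.map φ.ringHom ψ.series) = PowerSeries.X :=
    congrArg FGLHom.series h
  have e' := PowerSeries.coeff_one_subst (g := PowerSeries.map φ.ringHom ψ.series)
    φ.isHom.constantCoeff_eq_zero
  rw [e, PowerSeries.coeff_one_X] at e'
  exact .of_mul_eq_one _ ((mul_comm _ _).trans e'.symm)

end

theorem mainTheorem5 {R : Type*} [CommRing R] [IsLocalRing R] [IsNoetherianRing R]
    [IsAdicComplete (maximalIdeal R) R] (p n : ℕ) (hp : p.Prime) [CharP (ResidueField R) p]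
    (F G : FormalGroup (ResidueField R)) [F.IsComm] [G.IsComm]
    (hF : F.HasHeight p n) (hG : G.HasHeight p n)
    (φ₀ : FGLHom F G) (hφ₀ : φ₀.IsIso)
    (α : R ≃+* R) (hα : ∀ r : R, φ₀.ringHom (residue R r) = residue R (α r))
    (Ft Gt : FormalGroup (MvPowerSeries (Fin (n - 1)) R))
    (hFt : IsUniversalDeformation F Ft) (hGt : IsUniversalDeformation G Gt) :
    ∃! φ : FGLHom Ft Gt, φ.IsIso ∧ φ.InducesOnResidueField φ₀ ∧
      (MvPowerSeries.C : R →+* MvPowerSeries (Fin (n - 1)) R).comp (α : R →+* R) =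
        φ.ringHom.comp (MvPowerSeries.C : R →+* MvPowerSeries (Fin (n - 1)) R) := by
  obtain ⟨ψ₀, hφψ, hψφ⟩ := hφ₀
  have hu := FGLHom.isUnit_coeff_one_of_comp_eq_id hψφ
  have hu' := FGLHom.isUnit_coeff_one_of_comp_eq_id hφψ
  -- The inverse of `α` induces the ring map of the inverse of `φ₀`, so the existence result also
  -- applies in the other direction.
  have hα' (r : R) : ψ₀.ringHom (residue R r) = residue R (α.symm r) := by
    have h := RingHom.congr_fun (congrArg FGLHom.ringHom hφψ) (residue R (α.symm r))
    change ψ₀.ringHom (φ₀.ringHom _) = residue R _ at h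
    rwa [hα, α.apply_symm_apply] at h
  have hid {K : FormalGroup (ResidueField R)} (r : R) :
      (FGLHom.id K).ringHom (residue R r) = residue R (RingHom.id R r) := rfl
  obtain ⟨φ, hφ⟩ := FGLHom.exists_isLift (α := (α : R →+* R)) hFt.isDeformation hGt hu hα
  obtain ⟨ψ, hψ⟩ :=
    FGLHom.exists_isLift (α := (α.symm : R →+* R)) hGt.isDeformation hFt hu' hα'
  have h₁ := hφ.comp hψ
  have h₂ := hψ.comp hφ
  rw [hφψ, RingEquiv.symm_comp] at h₁
  rw [hψφ, RingEquiv.comp_symm] at h₂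
  refine ⟨φ, ⟨⟨ψ, ?_, ?_⟩, hφ.1, hφ.2⟩, fun φ' hφ' => FGLHom.IsLift.unique hp hF hG
    hFt.isDeformation hGt hu hα ⟨hφ'.2.1, hφ'.2.2⟩ hφ⟩
  -- Each composite and the identity lift the same identity on residue fields, over the identity of
  -- `R`.
  · exact h₁.unique hp hG hG hGt.isDeformation hGt (by simp [FGLHom.id]) hid FGLHom.isLift_id
  · exact h₂.unique hp hF hF hFt.isDeformation hFt (by simp [FGLHom.id]) hid FGLHom.isLift_id
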